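/- Let $F$ be a closed connected orientable surface (a projection surface in an orientable $3$-manifold $Y$), let $K$ be a knot in a thickening $F\times I\subset Y$ and let $\pi(K)\subset F$ be its diagram. Suppose that $\pi(K)$ has at least one crossing, is alternating, and is checkerboard coloured, i.e. the components of $F\setminus\pi(K)$ (the regions, which need not be disks) are coloured red and blue so that regions on the two sides of an edge have different colours; in particular, $\pi(K)$ may be any weakly generalized alternating diagram of a knot. If $F$ is a sphere, suppose that $\pi(K)$ has at least two crossings. A twist region of $\pi(K)$ is a maximal string of crossings, consecutive ones being joined by bigon regions, or a single crossing that is a corner of no bigon with a second crossing. Fix $N\ge 3$ and let $\mathrm{tw}_N(K)$ be the number of twist regions with at least $N$ crossings. Let $K_2$ be a diagram obtained from $\pi(K)$ by removing pairs of crossings from each twist region with at least $N$ crossings until only one or two crossings remain in it, and let $\mathrm{cr}(K_2)$ be its number of crossings. Around each of these twist regions put a crossing circle. It meets $F$ in two points, which lie in the regions of $K_2$ beside the string of bigons; these two regions have the same colour. The twisted surfaces $S_{R,2}$ and $S_{B,2}$ are the (abstract, immersed in $Y\setminus K$) surfaces obtained as follows. Take the red (respectively blue) checkerboard surface of $K_2$,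 formed by the regions of that colour joined along the vertical crossing arcs at all crossings, and remove a disk around each point at which it meets a crossing circle. For every crossing circle that meets it, with $2n$ crossings removed from the corresponding twist region, glue an annulus to the two resulting boundary circles if $n$ is odd, and a Möbius band to each of them if $n$ is even. Then the Euler characteristics satisfy $$|\chi(S_{R,2})+\chi(S_{B,2})| = \mathrm{cr}(K_2)+2\,\mathrm{tw}_N(K)-\chi(F).$$ -/

import Mathlib

/-! Finite complexes made of compact surfaces glued to a graph. -/

/-- The number of cycles (fixed points included) of a permutation. -/
noncomputable def cycleCount {α : Type} (p : Equiv.Perm α) : ℕ :=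
  Nat.card (Quotient (Equiv.Perm.SameCycle.setoid p))

/-- The homeomorphism type of a closed connected surface: the orientable surface with `g` handles,
or the sphere with `k` crosscaps. -/
inductive SurfaceKind where
  | orientable (g : ℕ)
  | nonorientable (k : ℕ)

/-- The Euler characteristic of the closed surface of the given kind. -/
def SurfaceKind.closedEulerChar : SurfaceKind → ℤ
  | .orientable g => 2 - 2 * (g : ℤ)
  | .nonorientable k => 2 - (k : ℤ)

/-- A finite graph together with finitely many compact connected surfaces with boundary (the
pieces), whose boundary circles are attached to the graph along closed edge paths.

The graph is given by its oriented edges (`Dart`), their reversal and their initial vertices.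
The boundary circles of all pieces are cut into `Side`s; each side is attached along one oriented
edge, `next` sends a side to the one that follows it on its boundary circle, and so the boundary
circles are the cycles of `next`.  A piece `p` is obtained from a closed surface of kind `kind p`
by removing an open disk for every boundary circle that it owns.  For an orientable piece the sides
are run through in the direction of the boundary orientation. -/
structure SurfaceComplex where
  Vert : Type
  Dart : Type
  Piece : Type
  Side : Type
  finite_vert : Finite Vert
  finite_dart : Finite Dart
  finite_piece : Finite Piece
  finite_side : Finite Side
  rev : Equiv.Perm Dart
  rev_rev : ∀ d, rev (rev d) = d
  rev_ne : ∀ d, rev d ≠ d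
  src : Dart → Vert
  kind : Piece → SurfaceKind
  next : Equiv.Perm Side
  owner : Side → Piece
  owner_next : ∀ s, owner (next s) = owner s
  dart : Side → Dart
  dart_next : ∀ s, src (rev (dart s)) = src (dart (next s))

namespace SurfaceComplex

/-- The number of boundary circles of a piece. -/
noncomputable def circles (X : SurfaceComplex) (p : X.Piece) : ℕ :=
  ((Quotient.mk (Equiv.Perm.SameCycle.setoid X.next)) '' {s | X.owner s = p}).ncard

/-- The Euler characteristic of a piece, a compact surface with boundary. -/
noncomputable def pieceEulerChar (X : SurfaceComplex) (p : X.Piece) : ℤ :=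
  (X.kind p).closedEulerChar - (X.circles p : ℤ)

/-- The Euler characteristic: vertices minus edges plus the Euler characteristics of the pieces
(circles have Euler characteristic zero; if all pieces are disks, this is `V - E + F`). -/
noncomputable def eulerChar (X : SurfaceComplex) : ℤ :=
  (Nat.card X.Vert : ℤ) - (cycleCount X.rev : ℤ) + ∑ᶠ p, X.pieceEulerChar p

end SurfaceComplex

/-! Diagrams on surfaces. -/

/-- A checkerboard coloured link diagram, every component of which has crossings, on a closed
oriented surface `F`, every component of which meets the diagram.

The four half-edges at a crossing `c` are `(c, i)` for `i` in `ℤ/4`, in counterclockwise order.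
`glue` joins the two half-edges of each edge of the diagram.  The pair `(c, i)` also stands for the
corner at `c` between the half-edges `(c, i)` and `(c, i + 1)`.  `Reg` is the set of regions, that
is, of components of the complement of the diagram in `F`, and `reg x` is the region to which the
corner `x` belongs.  A region need not be a disk: it is an orientable surface with `genus` handles
and some number of boundary circles.  Leaving the corner `(c, i)` along its half-edge `(c, i)`, with
the region on the left, one arrives by the half-edge `(c', j) = glue (c, i)` in the corner
`(c', j - 1)` of the same region.  `upper d` tells whether `d` lies on the overstrand
of its crossing, and `red r` whether the region `r` is red (otherwise it is blue). -/
structure Diagram where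
  Cr : Type
  Reg : Type
  finite_cr : Finite Cr
  finite_reg : Finite Reg
  glue : Equiv.Perm (Cr × ZMod 4)
  glue_glue : ∀ d, glue (glue d) = d
  glue_ne : ∀ d, glue d ≠ d
  reg : Cr × ZMod 4 → Reg
  reg_surjective : Function.Surjective reg
  reg_next : ∀ d, reg ((glue d).1, (glue d).2 - 1) = reg d
  genus : Reg → ℕ
  upper : Cr × ZMod 4 → Bool
  upper_succ : ∀ c i, upper (c, i + 1) = !upper (c, i)
  red : Reg → Bool
  red_adjacent : ∀ c i, red (reg (c, i - 1)) ≠ red (reg (c, i))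

namespace Diagram

attribute [instance] Diagram.finite_cr Diagram.finite_reg

/-- Half-edges, and also corners. -/
abbrev Corner (D : Diagram) : Type := D.Cr × ZMod 4

/-- The corner that follows a given one on the boundary of its region. -/
def next (D : Diagram) : Equiv.Perm D.Corner :=
  D.glue.trans (Equiv.prodCongr (Equiv.refl D.Cr) (Equiv.subRight (1 : ZMod 4)))

theorem next_apply (D : Diagram) (d : D.Corner) :
    D.next d = ((D.glue d).1, (D.glue d).2 - 1) := rfl

theorem reg_next_apply (D : Diagram) (d : D.Corner) : D.reg (D.next d) = D.reg d := D.reg_next d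

/-- The number of crossings. -/
noncomputable def crossingNumber (D : Diagram) : ℕ := Nat.card D.Cr

/-- The projection surface `F`: the graph of the diagram with the regions attached. -/
def surface (D : Diagram) : SurfaceComplex where
  Vert := D.Cr
  Dart := D.Corner
  Piece := D.Reg
  Side := D.Corner
  finite_vert := inferInstance
  finite_dart := inferInstance
  finite_piece := inferInstance
  finite_side := inferInstance
  rev := D.glue
  rev_rev := D.glue_glue
  rev_ne := D.glue_ne
  src := Prod.fst
  kind r := .orientable (D.genus r)
  next := D.next
  owner := D.reg
  owner_next := D.reg_next
  dart := id
  dart_next _ := rfl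

/-- Running along the link: follow an edge, then go straight on through the crossing. -/
def travel (D : Diagram) : Equiv.Perm D.Corner :=
  D.glue.trans (Equiv.prodCongr (Equiv.refl D.Cr) (Equiv.addRight (2 : ZMod 4)))

/-- The link has a single component, and its diagram has at least one crossing. -/
def IsKnot (D : Diagram) : Prop :=
  Nonempty D.Cr ∧
    ∀ d e : D.Corner, D.travel.SameCycle d e ∨ D.travel.SameCycle d (D.glue e)

/-- Every edge runs from an overcrossing to an undercrossing. -/
def IsAlternating (D : Diagram) : Prop := ∀ d : D.Corner, D.upper (D.glue d) = !D.upper d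

/-! Twist regions. -/

/-- The corner `x` belongs to a bigon: its region is a disk with exactly two corners. -/
def IsBigonCorner (D : Diagram) (x : D.Corner) : Prop :=
  D.genus (D.reg x) = 0 ∧ D.next x ≠ x ∧ ∀ y, D.reg y = D.reg x → y = x ∨ y = D.next x

/-- Two different crossings are adjacent if they are the two corners of a bigon. -/
def bigonGraph (D : Diagram) : SimpleGraph D.Cr :=
  SimpleGraph.fromRel fun c c' => ∃ x, D.IsBigonCorner x ∧ x.1 = c ∧ (D.next x).1 = c'

/-- A twist region is (given by the set of crossings of) a maximal string of bigons, or a single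
crossing that is not adjacent to any bigon. -/
abbrev TwistRegion (D : Diagram) : Type := D.bigonGraph.ConnectedComponent

/-- The twist region of a crossing. -/
def twistRegion (D : Diagram) (c : D.Cr) : D.TwistRegion := D.bigonGraph.connectedComponentMk c

/-- The number of crossings in a twist region. -/
noncomputable def size (D : Diagram) (T : D.TwistRegion) : ℕ := {c | D.twistRegion c = T}.ncard

/-- The twist regions with at least `N` crossings. -/
abbrev LargeTwistRegion (D : Diagram) (N : ℕ) : Type := {T : D.TwistRegion // N ≤ D.size T}

/-- The number of twist regions with at least `N` crossings. -/
noncomputable def tw (D : Diagram) (N : ℕ) : ℕ := Nat.card (D.LargeTwistRegion N)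

/-! Removing a pair of crossings from a twist region. -/

/-- Three different crossings `c₁`, `c₂`, `c₃` in a row: a bigon with corners `(c₁, i)` and
`(c₂, j)`, and a bigon with corners `(c₂, j + 2)` (opposite at `c₂` to the first bigon) and
`(c₃, k)`. -/
structure Row (D : Diagram) where
  c₁ : D.Cr
  c₂ : D.Cr
  c₃ : D.Cr
  i : ZMod 4
  j : ZMod 4
  k : ZMod 4
  ne₁₂ : c₁ ≠ c₂
  ne₁₃ : c₁ ≠ c₃
  ne₂₃ : c₂ ≠ c₃
  bigon₁ : D.IsBigonCorner (c₁, i)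
  bigon₂ : D.IsBigonCorner (c₂, j + 2)
  next₁ : D.next (c₁, i) = (c₂, j)
  next₂ : D.next (c₂, j + 2) = (c₃, k)

namespace Row

variable {D : Diagram} (t : D.Row)

/-- The crossings that remain when `c₂` and `c₃` are removed. -/
abbrev Rest : Type := {c : D.Cr // c ≠ t.c₂ ∧ c ≠ t.c₃}

open Classical in
/-- After the removal of `c₂` and `c₃`, the two half-edges of `c₁` next to the first bigon are
continued by the half-edges by which the strands used to leave `c₃`. -/
noncomputable def old (d : t.Rest × ZMod 4) : D.Corner :=
  if d.1.1 = t.c₁ ∧ d.2 = t.i then (t.c₃, t.k + 2)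
  else if d.1.1 = t.c₁ ∧ d.2 = t.i + 1 then (t.c₃, t.k + 3)
  else (d.1.1, d.2)

theorem next_next_of_bigon {x : D.Corner} (h : D.IsBigonCorner x) : D.next (D.next x) = x := by
  rcases h.2.2 (D.next (D.next x)) (by rw [D.reg_next_apply, D.reg_next_apply]) with h' | h'
  · exact h'
  · exact absurd (D.next.injective h') h.2.1

theorem glue_of_next {c c' : D.Cr} {i i' : ZMod 4} (h : D.next (c, i) = (c', i')) :
    D.glue (c, i) = (c', i' + 1) := by
  rw [next_apply, Prod.mk.injEq] at h
  ext
  · exact h.1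
  · simp [← h.2]

theorem glue₁ : D.glue (t.c₁, t.i) = (t.c₂, t.j + 1) := glue_of_next t.next₁

theorem glue₂ : D.glue (t.c₂, t.j) = (t.c₁, t.i + 1) :=
  glue_of_next (by rw [← t.next₁]; exact next_next_of_bigon t.bigon₁)

theorem glue₃ : D.glue (t.c₂, t.j + 2) = (t.c₃, t.k + 1) := glue_of_next t.next₂

theorem glue₄ : D.glue (t.c₃, t.k) = (t.c₂, t.j + 2 + 1) :=
  glue_of_next (by rw [← t.next₂]; exact next_next_of_bigon t.bigon₂)

/-- The half-edges that disappear. -/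
def Gone (d : D.Corner) : Prop :=
  d.1 = t.c₂ ∨ (d.1 = t.c₁ ∧ (d.2 = t.i ∨ d.2 = t.i + 1)) ∨
    (d.1 = t.c₃ ∧ (d.2 = t.k ∨ d.2 = t.k + 1))

theorem zmod_four_cases (a b : ZMod 4) : b = a ∨ b = a + 1 ∨ b = a + 2 ∨ b = a + 3 := by
  revert a b; decide

theorem gone_glue {d : D.Corner} (h : t.Gone d) : t.Gone (D.glue d) := by
  have g1 := t.glue₁
  have g2 := t.glue₂
  have g3 := t.glue₃
  have g4 := t.glue₄
  have g1' : D.glue (t.c₂, t.j + 1) = (t.c₁, t.i) := by rw [← g1, D.glue_glue]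
  have g2' : D.glue (t.c₁, t.i + 1) = (t.c₂, t.j) := by rw [← g2, D.glue_glue]
  have g3' : D.glue (t.c₃, t.k + 1) = (t.c₂, t.j + 2) := by rw [← g3, D.glue_glue]
  have g4' : D.glue (t.c₂, t.j + 3) = (t.c₃, t.k) := by
    have e : t.j + 3 = t.j + 2 + 1 := by ring
    rw [e, ← g4, D.glue_glue]
  obtain ⟨c, a⟩ := d
  rcases h with h | ⟨h, h' | h'⟩ | ⟨h, h' | h'⟩ <;> simp only at h <;> try simp only at h'
  · subst h
    rcases zmod_four_cases t.j a with e | e | e | e <;> rw [e]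
    · rw [g2]; simp [Gone]
    · rw [g1']; simp [Gone]
    · rw [g3]; simp [Gone]
    · rw [g4']; simp [Gone]
  · rw [h, h', g1]; simp [Gone]
  · rw [h, h', g2']; simp [Gone]
  · rw [h, h', g4]; simp [Gone]
  · rw [h, h', g3']; simp [Gone]

theorem gone_glue_iff (d : D.Corner) : t.Gone (D.glue d) ↔ t.Gone d :=
  ⟨fun h => by simpa [D.glue_glue] using t.gone_glue h, t.gone_glue⟩

theorem not_gone_old (d : t.Rest × ZMod 4) : ¬ t.Gone (t.old d) := by
  have e : ∀ a : ZMod 4, a + 2 ≠ a ∧ a + 2 ≠ a + 1 ∧ a + 3 ≠ a ∧ a + 3 ≠ a + 1 := by decide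
  obtain ⟨e1, e2, e3, e4⟩ := e t.k
  obtain ⟨⟨c, hc2, hc3⟩, a⟩ := d
  unfold old
  split_ifs with h h'
  · rintro (h1 | ⟨h1, -⟩ | ⟨-, h1 | h1⟩)
    exacts [t.ne₂₃ h1.symm, t.ne₁₃ h1.symm, e1 h1, e2 h1]
  · rintro (h1 | ⟨h1, -⟩ | ⟨-, h1 | h1⟩)
    exacts [t.ne₂₃ h1.symm, t.ne₁₃ h1.symm, e3 h1, e4 h1]
  · rintro (h1 | ⟨h1, h2 | h2⟩ | ⟨h1, -⟩)
    exacts [hc2 h1, h ⟨h1, h2⟩, h' ⟨h1, h2⟩, hc3 h1]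

theorem exists_old {e : D.Corner} (he : ¬ t.Gone e) : ∃ d, t.old d = e := by
  obtain ⟨c, a⟩ := e
  have e1 : ∀ a : ZMod 4, a + 1 ≠ a := by decide
  by_cases h3 : c = t.c₃
  · subst h3
    rcases zmod_four_cases t.k a with h | h | h | h
    · exact absurd (Or.inr (Or.inr ⟨rfl, Or.inl h⟩)) he
    · exact absurd (Or.inr (Or.inr ⟨rfl, Or.inr h⟩)) he
    · exact ⟨(⟨t.c₁, t.ne₁₂, t.ne₁₃⟩, t.i), by simp [old, h]⟩
    · exact ⟨(⟨t.c₁, t.ne₁₂, t.ne₁₃⟩, t.i + 1), by simp [old, h, e1]⟩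
  · have h2 : c ≠ t.c₂ := fun h => he (Or.inl h)
    refine ⟨(⟨c, h2, h3⟩, a), ?_⟩
    unfold old
    rw [if_neg, if_neg]
    · exact fun h => he (Or.inr (Or.inl ⟨h.1, Or.inr h.2⟩))
    · exact fun h => he (Or.inr (Or.inl ⟨h.1, Or.inl h.2⟩))

theorem old_injective : Function.Injective t.old := by
  rintro ⟨⟨c, hc2, hc3⟩, a⟩ ⟨⟨c', hc2', hc3'⟩, a'⟩ h
  have e : ∀ a : ZMod 4, a + 2 ≠ a + 3 := by decide
  unfold old at h
  simp only at h
  split_ifs at h with h1 h2 h3 h4 h5 h6 h7 h8 <;>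
    simp only [Prod.mk.injEq, true_and, Subtype.mk.injEq] at h ⊢
  all_goals first
    | exact h
    | exact absurd h (e _)
    | exact absurd h.symm (e _)
    | exact absurd h.1 hc3
    | exact absurd h.1.symm hc3'
    | (constructor <;> simp_all)

/-- The half-edges of the new diagram are the half-edges of the old one that did not disappear. -/
noncomputable def oldEquiv : (t.Rest × ZMod 4) ≃ {e : D.Corner // ¬ t.Gone e} :=
  Equiv.ofBijective (fun d => ⟨t.old d, t.not_gone_old d⟩)
    ⟨fun _ _ h => t.old_injective (congrArg Subtype.val h), fun e => by
      obtain ⟨d, hd⟩ := t.exists_old e.2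
      exact ⟨d, Subtype.ext hd⟩⟩

/-- The edges of the new diagram. -/
noncomputable def newGlue : Equiv.Perm (t.Rest × ZMod 4) :=
  (t.oldEquiv.trans (D.glue.subtypePerm
    (fun e => (not_congr (t.gone_glue_iff e))))).trans t.oldEquiv.symm

theorem old_newGlue (d : t.Rest × ZMod 4) : t.old (t.newGlue d) = D.glue (t.old d) := by
  have h : t.oldEquiv (t.newGlue d) = _ := t.oldEquiv.apply_symm_apply _
  exact congrArg Subtype.val h

theorem reg_side : D.reg (t.c₁, t.i - 1) = D.reg (t.c₃, t.k + 1) := by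
  have h1 := D.reg_next (t.c₃, t.k + 1)
  have h2 := D.reg_next (t.c₂, t.j + 1)
  have g1 : D.glue (t.c₂, t.j + 1) = (t.c₁, t.i) := by rw [← t.glue₁, D.glue_glue]
  have g3 : D.glue (t.c₃, t.k + 1) = (t.c₂, t.j + 2) := by rw [← t.glue₃, D.glue_glue]
  rw [g3] at h1
  rw [g1] at h2
  have e : t.j + 2 - 1 = t.j + 1 := by ring
  simp only [e] at h1 h2
  rw [h2, h1]

theorem reg_side' : D.reg (t.c₁, t.i + 1) = D.reg (t.c₃, t.k + 3) := by
  have h1 := D.reg_next (t.c₁, t.i + 1)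
  have h2 := D.reg_next (t.c₂, t.j + 3)
  have g2 : D.glue (t.c₁, t.i + 1) = (t.c₂, t.j) := by rw [← t.glue₂, D.glue_glue]
  have g4 : D.glue (t.c₂, t.j + 3) = (t.c₃, t.k) := by
    have e : t.j + 3 = t.j + 2 + 1 := by ring
    rw [e, ← t.glue₄, D.glue_glue]
  rw [g2] at h1
  rw [g4] at h2
  have e : ∀ a : ZMod 4, a - 1 = a + 3 := by decide
  simp only [e] at h1 h2
  rw [← h1, ← h2]

/-- The side of an edge that is given by the clockwise neighbour of a half-edge. -/
theorem reg_old_pred (c : t.Rest) (a : ZMod 4) :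
    D.reg (t.old (c, a - 1)) = D.reg ((t.old (c, a)).1, (t.old (c, a)).2 - 1) := by
  have e0 : ∀ b : ZMod 4, b - 1 ≠ b ∧ b - 1 ≠ b + 1 ∧ b + 1 ≠ b := by decide
  have e2 : t.k + 2 - 1 = t.k + 1 := by ring
  have e3 : t.k + 3 - 1 = t.k + 2 := by ring
  have e4 : t.i + 1 - 1 = t.i := by ring
  obtain ⟨c, hc⟩ := c
  by_cases h : c = t.c₁
  · subst h
    rcases zmod_four_cases t.i a with h | h | h | h <;> subst h
    · have := e0 t.i
      simp [old, this.1, this.2.1, e2, t.reg_side]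
    · have := e0 t.i
      simp [old, this.2.2, e3, e4]
    · have h1 : ∀ b : ZMod 4, b + 2 - 1 = b + 1 ∧ b + 2 ≠ b ∧ b + 2 ≠ b + 1 ∧ b + 1 ≠ b := by
        decide
      obtain ⟨h1, h2, h3, h4⟩ := h1 t.i
      simp only [old, h1, h2, h3, h4, and_false, if_false, true_and, if_true, t.reg_side']
    · have h1 : ∀ b : ZMod 4, b + 3 - 1 ≠ b + 1 ∧ b + 3 - 1 ≠ b ∧ b + 3 ≠ b ∧ b + 3 ≠ b + 1 := by
        decide
      obtain ⟨h1, h2, h3, h4⟩ := h1 t.i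
      simp only [old, h1, h2, h3, h4, and_false, if_false]
  · simp [old, h]

theorem reg_old_ne (d : t.Rest × ZMod 4) :
    D.reg (t.old d) ≠ D.reg (t.c₁, t.i) ∧ D.reg (t.old d) ≠ D.reg (t.c₂, t.j + 2) := by
  have hd := t.not_gone_old d
  constructor
  · intro h
    rcases t.bigon₁.2.2 _ h with h' | h'
    · exact hd (by rw [h']; simp [Gone])
    · exact hd (by rw [h', t.next₁]; simp [Gone])
  · intro h
    rcases t.bigon₂.2.2 _ h with h' | h'
    · exact hd (by rw [h']; simp [Gone])
    · exact hd (by rw [h', t.next₂]; simp [Gone])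

theorem exists_reg_old {r : D.Reg} (h1 : r ≠ D.reg (t.c₁, t.i))
    (h2 : r ≠ D.reg (t.c₂, t.j + 2)) : ∃ d, D.reg (t.old d) = r := by
  obtain ⟨x, rfl⟩ := D.reg_surjective r
  by_contra hx
  have key : ∀ y, D.reg y = D.reg x → t.Gone y := fun y hy => by
    by_contra hg
    obtain ⟨d, hd⟩ := t.exists_old hg
    exact hx ⟨d, by rw [hd, hy]⟩
  have b1 : D.reg (t.c₂, t.j) = D.reg (t.c₁, t.i) := by rw [← t.next₁, D.reg_next_apply]
  have b2 : D.reg (t.c₃, t.k) = D.reg (t.c₂, t.j + 2) := by rw [← t.next₂, D.reg_next_apply]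
  have ec : ∀ a : ZMod 4, a - 1 = a + 3 ∧ a + 2 - 1 = a + 1 := by decide
  have e3 : ∀ a : ZMod 4, a + 3 ≠ a ∧ a + 3 ≠ a + 1 := by decide
  have s1 : D.reg (t.c₂, t.j + 1) = D.reg (t.c₁, t.i + 3) := by
    have h := D.reg_next (t.c₂, t.j + 1)
    have g : D.glue (t.c₂, t.j + 1) = (t.c₁, t.i) := by rw [← t.glue₁, D.glue_glue]
    rw [g] at h
    rw [← h, (ec t.i).1]
  have s3 : D.reg (t.c₃, t.k + 1) = D.reg (t.c₁, t.i + 3) := by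
    rw [← t.reg_side, (ec t.i).1]
  have n2 : D.reg (t.c₂, t.j + 3) = D.reg (t.c₃, t.k + 3) := by
    have h := D.reg_next (t.c₂, t.j + 3)
    have e : t.j + 3 = t.j + 2 + 1 := by ring
    have g : D.glue (t.c₂, t.j + 3) = (t.c₃, t.k) := by rw [e, ← t.glue₄, D.glue_glue]
    rw [g] at h
    rw [← h, (ec t.k).1]
  have ng1 : ¬ t.Gone (t.c₁, t.i + 3) := by
    have := e3 t.i
    simp [Gone, t.ne₁₂, t.ne₁₃, this.1, this.2]
  have ng3 : ¬ t.Gone (t.c₃, t.k + 3) := by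
    have := e3 t.k
    simp [Gone, t.ne₂₃.symm, t.ne₁₃.symm, this.1, this.2]
  obtain ⟨c, a⟩ := x
  rcases key _ rfl with h | ⟨h, h' | h'⟩ | ⟨h, h' | h'⟩ <;> simp only at h <;> subst h
  · rcases zmod_four_cases t.j a with e | e | e | e <;> subst e
    · exact h1 b1
    · exact ng1 (key _ s1.symm)
    · exact h2 rfl
    · exact ng3 (key _ n2.symm)
  · simp only at h'
    subst h'
    exact h1 rfl
  · simp only at h'
    subst h'
    exact ng3 (key _ t.reg_side'.symm)
  · simp only at h'
    subst h'
    exact h2 b2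
  · simp only at h'
    subst h'
    exact ng1 (key _ s3.symm)

end Row

/-- Removing a pair of crossings from a twist region: of three crossings `c₁`, `c₂`, `c₃` in a row
only `c₁` remains, and the two bigons between them disappear.  The strands that left `c₃`
on the far side now leave `c₁`.  Nothing else changes. -/
noncomputable def removePair (D : Diagram) (t : D.Row) : Diagram where
  Cr := t.Rest
  Reg := {r : D.Reg // r ≠ D.reg (t.c₁, t.i) ∧ r ≠ D.reg (t.c₂, t.j + 2)}
  finite_cr := inferInstance
  finite_reg := inferInstance
  glue := t.newGlue
  glue_glue d := t.old_injective (by rw [t.old_newGlue, t.old_newGlue, D.glue_glue])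
  glue_ne d h := D.glue_ne (t.old d) (by rw [← t.old_newGlue, h])
  reg d := ⟨D.reg (t.old d), t.reg_old_ne d⟩
  reg_surjective r := by
    obtain ⟨d, hd⟩ := t.exists_reg_old r.2.1 r.2.2
    exact ⟨d, Subtype.ext hd⟩
  reg_next d := Subtype.ext (by
    change D.reg (t.old ((t.newGlue d).1, (t.newGlue d).2 - 1)) = D.reg (t.old d)
    rw [t.reg_old_pred, t.old_newGlue, D.reg_next])
  genus r := D.genus r.1
  upper d := D.upper (d.1.1, d.2)
  upper_succ c i := D.upper_succ c.1 i
  red r := D.red r.1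
  red_adjacent c i := by
    change D.red (D.reg (t.old (c, i - 1))) ≠ D.red (D.reg (t.old (c, i)))
    rw [t.reg_old_pred]
    exact D.red_adjacent _ _

/-- `PairRemovals D N D' f`: the diagram `D'` arises from `D` by successively removing pairs of
crossings from twist regions of `D` with at least `N` crossings.  The map `f` sends each
remaining crossing to the crossing of `D` that it is. -/
inductive PairRemovals (D : Diagram) (N : ℕ) : (D' : Diagram) → (D'.Cr → D.Cr) → Prop
  | refl : PairRemovals D N D id
  | step (D' : Diagram) (f : D'.Cr → D.Cr) (t : D'.Row) (h : PairRemovals D N D' f)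
      (large : N ≤ D.size (D.twistRegion (f t.c₁)))
      (same₂ : D.twistRegion (f t.c₂) = D.twistRegion (f t.c₁))
      (same₃ : D.twistRegion (f t.c₃) = D.twistRegion (f t.c₁)) :
      PairRemovals D N (D'.removePair t) (fun c => f c.1)

/-- The diagram of `L₂`: a diagram `K₂` obtained from `D` by removing pairs of crossings from every
twist region with at least `N` crossings until one or two crossings remain in it, together with a
crossing circle around each of these twist regions.

The crossing circle of `T` is recorded by a corner `mark T` of a remaining crossing of `T`
which, in `D`, lies in one of the bigons of `T`.  The crossing circle runs around the two strands
of `T`, so it meets the projection surface in two points, one in each of the two regions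
beside the string of bigons; these are the regions at the two corners adjacent to `mark T`. -/
structure Augmentation (D : Diagram) (N : ℕ) where
  K₂ : Diagram
  orig : K₂.Cr → D.Cr
  removals : PairRemovals D N K₂ orig
  remaining : ∀ T : D.LargeTwistRegion N,
    {c | D.twistRegion (orig c) = T.1}.ncard = 1 ∨ {c | D.twistRegion (orig c) = T.1}.ncard = 2
  mark : D.LargeTwistRegion N → K₂.Corner
  mark_mem : ∀ T, D.twistRegion (orig (mark T).1) = T.1
  mark_bigon : ∀ T, D.IsBigonCorner (orig (mark T).1, (mark T).2)

namespace Augmentation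

variable {D : Diagram} {N : ℕ} (A : D.Augmentation N)

/-- The number `n` of full twists by which `T` differs from what remains of it in `K₂`, that is, the
number of removed pairs of crossings. -/
noncomputable def fullTwists (T : D.LargeTwistRegion N) : ℕ :=
  (D.size T.1 - {c | D.twistRegion (A.orig c) = T.1}.ncard) / 2

/-- The regions of `K₂` that contain the two points of the crossing circle of `T`. -/
def sideReg (T : D.LargeTwistRegion N) : Bool → A.K₂.Reg
  | true => A.K₂.reg ((A.mark T).1, (A.mark T).2 + 1)
  | false => A.K₂.reg ((A.mark T).1, (A.mark T).2 - 1)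

theorem red_sideReg (T : D.LargeTwistRegion N) (b : Bool) :
    A.K₂.red (A.sideReg T b) = A.K₂.red (A.sideReg T true) := by
  have h1 := A.K₂.red_adjacent (A.mark T).1 (A.mark T).2
  have h2 := A.K₂.red_adjacent (A.mark T).1 ((A.mark T).2 + 1)
  rw [add_sub_cancel_right] at h2
  cases b
  · simp only [sideReg]
    revert h1 h2
    generalize A.K₂.red _ = u
    generalize A.K₂.red _ = v
    generalize A.K₂.red _ = w
    revert u v w
    decide
  · rfl

/-- The crossing circles that meet the surface of the given colour (`true` is red). -/
abbrev CrossCircle (col : Bool) : Type :=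
  {T : D.LargeTwistRegion N // A.K₂.red (A.sideReg T true) = col}

/-- The punctures that the crossing circles make in the surface of the given colour. -/
abbrev Puncture (col : Bool) : Type := A.CrossCircle col × Bool

/-- The regions of the given colour. -/
abbrev ColReg (col : Bool) : Type := {r : A.K₂.Reg // A.K₂.red r = col}

/-- The corners of the given colour. -/
abbrev ColCorner (col : Bool) : Type := {x : A.K₂.Corner // A.K₂.red (A.K₂.reg x) = col}

/-- The corner that follows a given one on the boundary of its region. -/
def colNext (col : Bool) : Equiv.Perm (A.ColCorner col) :=
  A.K₂.next.subtypePerm fun x => by rw [A.K₂.reg_next_apply]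

/-- The boundary of a region of the spanning surface runs, at each corner, along a crossing arc, and
then along an edge of the diagram to the next corner. -/
def regionNext (col : Bool) : Equiv.Perm (A.ColCorner col × Bool) where
  toFun s := match s with
    | (x, false) => (x, true)
    | (x, true) => (A.colNext col x, false)
  invFun s := match s with
    | (x, true) => (x, false)
    | (x, false) => ((A.colNext col).symm x, true)
  left_inv := by rintro ⟨x, _ | _⟩ <;> simp
  right_inv := by rintro ⟨x, _ | _⟩ <;> simp

/-- Reversal of the second coordinate. -/
def flip (α : Type) : Equiv.Perm (α × Bool) :=
  Equiv.prodCongr (Equiv.refl α) Equiv.boolNot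

open Classical in
/-- The band that is attached to a puncture: if the number `n` of full twists is odd, then opposite
points belong to different punctures, and both punctures of a crossing circle bound
one annulus; if `n` is even, each puncture bounds a Moebius band of its own. -/
noncomputable def band (col : Bool) (p : A.Puncture col) :
    {T : A.CrossCircle col // Odd (A.fullTwists T.1)} ⊕
      ({T : A.CrossCircle col // ¬ Odd (A.fullTwists T.1)} × Bool) :=
  if h : Odd (A.fullTwists p.1.1) then .inl ⟨p.1, h⟩ else .inr (⟨p.1, h⟩, p.2)

/-- The twisted checkerboard surface `S_{R,2}` (for `col = true`) or `S_{B,2}` (for `col = false`).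

Vertices: an upper (`true`) and a lower (`false`) point at each crossing of `K₂`, and one point on
each puncture.  Edges: the edges of `K₂` (which are the boundary of the surface), for each
crossing the vertical crossing arc, and for each puncture its boundary circle.
Pieces: the regions of `K₂` of the given colour, with a disk removed for each puncture; they are
joined along the crossing arcs, which gives the checkerboard surface of `K₂`, punctured by the
crossing circles; and an annulus or two Moebius bands for each crossing circle,
attached along its two punctures. -/
noncomputable def twistedSurface (col : Bool) : SurfaceComplex where
  Vert := (A.K₂.Cr × Bool) ⊕ A.Puncture col
  Dart := A.K₂.Corner ⊕ ((A.K₂.Cr × Bool) ⊕ (A.Puncture col × Bool))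
  Piece := A.ColReg col ⊕ ({T : A.CrossCircle col // Odd (A.fullTwists T.1)} ⊕
      ({T : A.CrossCircle col // ¬ Odd (A.fullTwists T.1)} × Bool))
  Side := (A.ColCorner col × Bool) ⊕ (A.Puncture col × Bool)
  finite_vert := inferInstance
  finite_dart := inferInstance
  finite_piece := inferInstance
  finite_side := inferInstance
  rev := Equiv.sumCongr A.K₂.glue (Equiv.sumCongr (flip _) (flip _))
  rev_rev := by rintro (d | ⟨d, _ | _⟩ | ⟨d, _ | _⟩) <;> simp [flip, A.K₂.glue_glue]
  rev_ne := by rintro (d | ⟨d, _ | _⟩ | ⟨d, _ | _⟩) <;> simp [flip, A.K₂.glue_ne]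
  src d := match d with
    | .inl d => .inl (d.1, A.K₂.upper d)
    | .inr (.inl (c, b)) => .inl (c, b)
    | .inr (.inr (p, _)) => .inr p
  kind p := match p with
    | .inl r => .orientable (A.K₂.genus r.1)
    | .inr (.inl _) => .orientable 0
    | .inr (.inr _) => .nonorientable 1
  next := Equiv.sumCongr (A.regionNext col) (Equiv.refl _)
  owner s := match s with
    | .inl (x, _) => .inl ⟨A.K₂.reg x.1, x.2⟩
    | .inr (p, false) => .inl ⟨A.sideReg p.1.1 p.2, by rw [A.red_sideReg]; exact p.1.2⟩
    | .inr (p, true) => .inr (A.band col p)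
  owner_next := by
    rintro (⟨x, _ | _⟩ | ⟨p, _ | _⟩)
    · rfl
    · exact congrArg Sum.inl (Subtype.ext (A.K₂.reg_next_apply x.1))
    · rfl
    · rfl
  dart s := match s with
    | .inl (x, false) => .inr (.inl (x.1.1, A.K₂.upper (x.1.1, x.1.2 + 1)))
    | .inl (x, true) => .inl x.1
    | .inr (p, b) => .inr (.inr (p, b))
  dart_next := by
    rintro (⟨⟨⟨c, i⟩, hx⟩, _ | _⟩ | ⟨p, _ | _⟩)
    · simp [regionNext, flip, A.K₂.upper_succ]
    · simp [regionNext, colNext, next_apply]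
    · rfl
    · rfl

end Augmentation

end Diagram

/-! Counting cycles of permutations. -/

/-! The identity inside the absolute value is additive bookkeeping. A checkerboard surface has the
Euler characteristic of its regions minus one for each crossing arc, so the two colours together
give the sum over all regions minus `2 cr(K₂)`. For the projection surface, vertices minus edges is
`cr - 2 cr`, so `χ` is the same sum over regions minus `cr`. A crossing circle meets the surface of
one colour only. Its two punctures lower `χ` by 2, and the annulus or the two Möbius bands
contribute 0. Hence the sum is `χ(F(K₂)) - cr(K₂) - 2 tw`, which is
`Augmentation.eulerChar_twistedSurface_add`. Removing a pair of crossings deletes two bigon disks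
and keeps `χ(F)` (`Row.eulerChar_surface_removePair`).

It remains to see that the sum is not positive. A knot diagram is connected, so `χ(F) ≤ 2`
(`IsKnot.eulerChar_surface_le`); this follows from the genus inequality
`cycleCount_add_le_of_transitive`, proved by linear algebra on invariant functions. If some pair was
removed, then `2 tw ≥ 2`. Otherwise `K₂` is the original diagram, which has a crossing, and at least
two of them if `χ(F) = 2`.

All counts of edges and boundary circles are cycle counts of permutations. -/

theorem cycleCount_eq_card {α β : Type} (p : Equiv.Perm α) (f : α → β)
    (hf : Function.Surjective f) (h : ∀ a b, f a = f b ↔ p.SameCycle a b) :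
    cycleCount p = Nat.card β := by
  refine Nat.card_congr (Equiv.ofBijective
    (Quotient.lift (s := Equiv.Perm.SameCycle.setoid p) f fun a b hab => (h a b).2 hab) ⟨?_, ?_⟩)
  · rintro ⟨a⟩ ⟨b⟩ hab
    exact Quotient.sound ((h a b).1 hab)
  · intro b
    obtain ⟨a, rfl⟩ := hf b
    exact ⟨Quotient.mk _ a, rfl⟩

theorem apply_eq_of_sameCycle {α β : Type} {p : Equiv.Perm α} {f : α → β}
    (hf : ∀ a, f (p a) = f a) {a b : α} (h : p.SameCycle a b) : f a = f b := by
  obtain ⟨n, rfl⟩ := h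
  suffices ∀ a, f ((p ^ n) a) = f a from (this a).symm
  induction n with
  | zero => simp
  | succ k ih => intro a; rw [zpow_add_one, Equiv.Perm.mul_apply, ih, hf]
  | pred k ih =>
    intro a
    rw [zpow_sub_one, Equiv.Perm.mul_apply, ih, ← hf]
    simp

/-- The `q`-cycle of `f a` is a `p`-invariant function of `a`. One step of `p` may correspond to
several steps of `q`, as happens when corners are inserted into a boundary circle. -/
theorem sameCycle_map {α β : Type} {p : Equiv.Perm α} {q : Equiv.Perm β} {f : α → β}
    (hf : ∀ a, q.SameCycle (f a) (f (p a))) {a b : α} (h : p.SameCycle a b) :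
    q.SameCycle (f a) (f b) := by
  have := apply_eq_of_sameCycle (p := p)
    (f := fun a => Quotient.mk (Equiv.Perm.SameCycle.setoid q) (f a))
    (fun a => Quotient.sound (hf a).symm) h
  exact Quotient.exact this

theorem cycleCount_refl (α : Type) : cycleCount (Equiv.refl α) = Nat.card α :=
  cycleCount_eq_card _ id Function.surjective_id fun _ _ =>
    ⟨fun h => Eq.sameCycle h _, fun h => apply_eq_of_sameCycle (fun _ => rfl) h⟩

theorem cycleCount_sumCongr {α β : Type} [Finite α] [Finite β] (p : Equiv.Perm α)
    (q : Equiv.Perm β) :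
    cycleCount (Equiv.sumCongr p q) = cycleCount p + cycleCount q := by
  rw [cycleCount.eq_def p, cycleCount.eq_def q, ← Nat.card_sum]
  refine cycleCount_eq_card _ (Sum.map (Quotient.mk (Equiv.Perm.SameCycle.setoid p))
    (Quotient.mk (Equiv.Perm.SameCycle.setoid q)))
    (Quotient.mk_surjective.sumMap Quotient.mk_surjective) fun a b => ⟨fun h => ?_, fun h => ?_⟩
  · rcases a with a | a <;> rcases b with b | b <;>
      simp only [Sum.map_inl, Sum.map_inr, Sum.inl.injEq, Sum.inr.injEq, reduceCtorEq] at h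
    · exact sameCycle_map (f := Sum.inl) (fun a => ⟨1, by simp⟩) (Quotient.exact h)
    · exact sameCycle_map (f := Sum.inr) (fun a => ⟨1, by simp⟩) (Quotient.exact h)
  · refine apply_eq_of_sameCycle ?_ h
    rintro (a | a)
    · exact congrArg Sum.inl (Quotient.sound ⟨-1, by simp⟩)
    · exact congrArg Sum.inr (Quotient.sound ⟨-1, by simp⟩)

theorem cycleCount_flip (α : Type) :
    cycleCount (Diagram.Augmentation.flip α) = Nat.card α := by
  refine cycleCount_eq_card _ Prod.fst Prod.fst_surjective fun a b => ⟨fun h => ?_, fun h => ?_⟩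
  · obtain ⟨a, s⟩ := a
    obtain ⟨b, s'⟩ := b
    obtain rfl : a = b := h
    by_cases hs : s = s'
    · subst hs; exact Equiv.Perm.SameCycle.refl _ _
    · exact ⟨1, by cases s <;> cases s' <;> simp_all [Diagram.Augmentation.flip]⟩
  · exact apply_eq_of_sameCycle (fun _ => rfl) h

/-- The cycles of an invertible map are distributed over the fibres of an invariant function. -/
theorem cycleCount_eq_sum_fibres {α β : Type} [Finite α] [Fintype β] (p : Equiv.Perm α)
    (f : α → β) (hf : ∀ a, f (p a) = f a) :
    cycleCount p = ∑ b, ((Quotient.mk (Equiv.Perm.SameCycle.setoid p)) '' {a | f a = b}).ncard := by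
  classical
  have := Fintype.ofFinite (Quotient (Equiv.Perm.SameCycle.setoid p))
  let F : Quotient (Equiv.Perm.SameCycle.setoid p) → β :=
    Quotient.lift (s := Equiv.Perm.SameCycle.setoid p) f fun a b hab => apply_eq_of_sameCycle hf hab
  rw [cycleCount, Nat.card_eq_fintype_card, ← Finset.card_univ,
    Finset.card_eq_sum_card_fiberwise (f := F) (t := Finset.univ) (fun _ _ => Finset.mem_univ _)]
  refine Finset.sum_congr rfl fun b _ => ?_
  rw [← Set.ncard_coe_finset]
  congr 1
  ext ⟨a⟩
  simp only [Finset.coe_filter, Finset.mem_univ, true_and]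
  constructor
  · exact fun h => ⟨a, h, rfl⟩
  · rintro ⟨a', h, h'⟩
    rw [← h]
    exact (apply_eq_of_sameCycle hf (Quotient.exact h')).symm

theorem ncard_image_mk_eq_cycleCount_subtypePerm {α : Type} [Finite α] (p : Equiv.Perm α)
    (P : α → Prop) (hP : ∀ a, P (p a) ↔ P a) :
    ((Quotient.mk (Equiv.Perm.SameCycle.setoid p)) '' {a | P a}).ncard =
      cycleCount (p.subtypePerm hP) := by
  rw [← Nat.card_coe_set_eq]
  symm
  refine cycleCount_eq_card _
    (fun a => ⟨Quotient.mk _ a.1, a.1, a.2, rfl⟩) ?_ fun a b => ?_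
  · rintro ⟨_, a, ha, rfl⟩
    exact ⟨⟨a, ha⟩, rfl⟩
  · exact Subtype.ext_iff.trans (Quotient.eq.trans Equiv.Perm.sameCycle_subtypePerm.symm)

theorem two_mul_cycleCount_of_involution {α : Type} [Finite α] (p : Equiv.Perm α)
    (h2 : ∀ a, p (p a) = a) (hne : ∀ a, p a ≠ a) : 2 * cycleCount p = Nat.card α := by
  classical
  have := Fintype.ofFinite α
  have := Fintype.ofFinite (Quotient (Equiv.Perm.SameCycle.setoid p))
  have key : ∀ a b, p.SameCycle a b ↔ b = a ∨ b = p a := by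
    intro a b
    constructor
    · intro h
      -- The unordered pair `{a, p a}` is invariant, so a cycle contains nothing else.
      have := apply_eq_of_sameCycle (p := p) (f := fun a => ({a, p a} : Set α))
        (fun a => by simp only [h2]; exact Set.pair_comm _ _) h
      have hb : b ∈ ({a, p a} : Set α) := by rw [this]; simp
      simpa using hb
    · rintro (rfl | rfl)
      · exact Equiv.Perm.SameCycle.refl _ _
      · exact ⟨1, by simp⟩
  rw [cycleCount, Nat.card_eq_fintype_card, Nat.card_eq_fintype_card, ← Finset.card_univ,
    ← Finset.card_univ (α := α), Finset.card_eq_sum_card_fiberwise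
      (f := Quotient.mk (Equiv.Perm.SameCycle.setoid p)) (t := Finset.univ)
      (fun _ _ => Finset.mem_univ _), mul_comm, ← smul_eq_mul, ← Finset.sum_const]
  refine Finset.sum_congr rfl fun q _ => ?_
  obtain ⟨a, rfl⟩ := Quotient.mk_surjective q
  rw [← Finset.card_pair (hne a).symm]
  congr 1
  ext b
  simp only [Finset.mem_insert, Finset.mem_singleton, Finset.mem_filter, Finset.mem_univ, true_and,
    Quotient.eq]
  rw [← key]
  exact Equiv.Perm.sameCycle_comm

/-! The genus inequality for a pair of permutations that generate a transitive group. -/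

/-- The functions that are invariant under a permutation. -/
def invariantFunctions {α : Type} (p : Equiv.Perm α) : Submodule ℝ (α → ℝ) where
  carrier := {f | ∀ a, f (p a) = f a}
  add_mem' hf hg a := by simp [hf a, hg a]
  zero_mem' _ := rfl
  smul_mem' c f hf a := by simp [hf a]

/-- Invariant functions are the functions on the set of cycles, so cycle counts become dimensions.
-/
theorem finrank_invariantFunctions {α : Type} [Finite α] (p : Equiv.Perm α) :
    Module.finrank ℝ (invariantFunctions p) = cycleCount p := by
  have : Fintype (Quotient (Equiv.Perm.SameCycle.setoid p)) := Fintype.ofFinite _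
  have h : invariantFunctions p = LinearMap.range (LinearMap.funLeft ℝ ℝ
      (Quotient.mk (Equiv.Perm.SameCycle.setoid p))) := by
    ext f
    constructor
    · intro hf
      exact ⟨Quotient.lift (s := Equiv.Perm.SameCycle.setoid p) f
        fun a b hab => apply_eq_of_sameCycle hf hab, rfl⟩
    · rintro ⟨g, rfl⟩ a
      exact congrArg g (Quotient.sound ⟨-1, by simp⟩)
  rw [h, LinearMap.finrank_range_of_inj
    (LinearMap.funLeft_injective_of_surjective _ _ _ Quotient.mk_surjective),
    Module.finrank_fintype_fun_eq_card, cycleCount, Nat.card_eq_fintype_card]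

/-- Permutations `p`, `q` of `n` points that generate a transitive group satisfy
`c(p) + c(q) + c(p q) ≤ n + 2`, where `c` is the number of cycles. -/
theorem cycleCount_add_le_of_transitive {α : Type} [Finite α] (p q : Equiv.Perm α)
    (h : ∀ a b, ∃ g ∈ Subgroup.closure {p, q}, g a = b) :
    cycleCount p + cycleCount q + cycleCount (p * q) ≤ Nat.card α + 2 := by
  classical
  have := Fintype.ofFinite α
  -- By transitivity a function invariant under both `p` and `q` is constant.
  have hconst : Module.finrank ℝ ↥(invariantFunctions p ⊓ invariantFunctions q) ≤ 1 := by
    have hle : invariantFunctions p ⊓ invariantFunctions q ≤ Submodule.span ℝ {fun _ => (1 : ℝ)} := by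
      rintro f ⟨hp, hq⟩
      have hinv : ∀ g ∈ Subgroup.closure {p, q}, ∀ a, f (g a) = f a := by
        intro g hg
        induction hg using Subgroup.closure_induction with
        | mem x hx =>
          rcases hx with rfl | rfl
          exacts [hp, hq]
        | one => intro a; rfl
        | mul x y _ _ hx hy => intro a; rw [Equiv.Perm.mul_apply, hx, hy]
        | inv x _ hx => intro a; rw [← hx (x⁻¹ a)]; simp
      rw [Submodule.mem_span_singleton]
      rcases isEmpty_or_nonempty α with hα | ⟨⟨a⟩⟩
      · exact ⟨0, Subsingleton.elim _ _⟩
      · refine ⟨f a, funext fun b => ?_⟩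
        obtain ⟨g, hg, rfl⟩ := h a b
        simp [hinv g hg]
    exact (Submodule.finrank_mono hle).trans ((finrank_span_le_card _).trans (by simp))
  let W := invariantFunctions p ⊔ invariantFunctions q
  -- The map `f ↦ f ∘ p - f`, restricted to the functions invariant under `p * q`, has its image
  -- orthogonal to `W`, and its kernel consists of the common invariants of `p` and `q`.
  let δ : (α → ℝ) →ₗ[ℝ] (α → ℝ) := LinearMap.funLeft ℝ ℝ p - LinearMap.id
  let β : invariantFunctions (p * q) →ₗ[ℝ] Module.Dual ℝ (α → ℝ) :=
    (dotProductEquiv ℝ α).toLinearMap ∘ₗ δ ∘ₗ Submodule.subtype _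
  have hrange : LinearMap.range β ≤ W.dualAnnihilator := by
    rintro _ ⟨⟨f, hf⟩, rfl⟩
    have hf' : ∀ a, f (p (q a)) = f a := hf
    rw [Submodule.dualAnnihilator_sup_eq]
    simp only [Submodule.mem_inf, Submodule.mem_dualAnnihilator]
    constructor
    · intro g (hg : ∀ a, g (p a) = g a)
      simp only [LinearMap.comp_apply, Submodule.subtype_apply, LinearEquiv.coe_coe,
        dotProductEquiv_apply_apply, dotProduct, β, δ, LinearMap.sub_apply, LinearMap.funLeft_apply,
        LinearMap.id_apply, Pi.sub_apply, sub_mul, Finset.sum_sub_distrib]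
      rw [sub_eq_zero, ← Equiv.sum_comp p (fun a => f a * g a)]
      simp only [hg]
    · intro g (hg : ∀ a, g (q a) = g a)
      simp only [LinearMap.comp_apply, Submodule.subtype_apply, LinearEquiv.coe_coe,
        dotProductEquiv_apply_apply, dotProduct, β, δ, LinearMap.sub_apply, LinearMap.funLeft_apply,
        LinearMap.id_apply, Pi.sub_apply, sub_mul, Finset.sum_sub_distrib]
      -- Reindexing by `q` turns `∑ f (p a) g a` into `∑ f (p (q a)) g (q a)`, which is `∑ f a g a`.
      rw [sub_eq_zero, ← Equiv.sum_comp q (fun a => f (p a) * g a)]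
      simp only [hg, hf']
  have hker : Module.finrank ℝ (LinearMap.ker β) ≤
      Module.finrank ℝ ↥(invariantFunctions p ⊓ invariantFunctions q) := by
    have hmem : ∀ f : LinearMap.ker β, f.1.1 ∈ invariantFunctions p ⊓ invariantFunctions q := by
      rintro ⟨⟨f, hf⟩, hk⟩
      have hk' : dotProductEquiv ℝ α (δ f) = 0 := hk
      rw [LinearEquiv.map_eq_zero_iff] at hk'
      have hp : ∀ a, f (p a) = f a := fun a => sub_eq_zero.1 (congrFun hk' a)
      exact ⟨hp, fun a => (hp _).symm.trans (hf a)⟩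
    refine LinearMap.finrank_le_finrank_of_injective
      (f := LinearMap.codRestrict _ (Submodule.subtype _ ∘ₗ Submodule.subtype _) hmem) ?_
    intro f g hfg
    exact Subtype.ext (Subtype.ext (congrArg (fun x => x.1) hfg))
  -- With `k` the dimension of the common invariants, `dim W = c(p) + c(q) - k` and `c(p q) ≤ (n -
  -- dim W) + k`; the `2` in the bound is `2 k` with `k ≤ 1`.
  have h1 := LinearMap.finrank_range_add_finrank_ker β
  have h2 := Submodule.finrank_mono hrange
  have h3 := Subspace.finrank_add_finrank_dualAnnihilator_eq W
  have h4 := Submodule.finrank_sup_add_finrank_inf_eq (invariantFunctions p) (invariantFunctions q)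
  simp only [finrank_invariantFunctions, Module.finrank_fintype_fun_eq_card] at h1 h3 h4
  rw [Nat.card_eq_fintype_card]
  change Module.finrank ℝ W + _ = _ at h4
  omega

/-! Euler characteristics of diagram surfaces and twisted surfaces. -/

namespace SurfaceComplex

/-- The boundary circles of the pieces are the cycles of `next`. -/
theorem finsum_pieceEulerChar (X : SurfaceComplex) :
    ∑ᶠ p, X.pieceEulerChar p =
      ∑ᶠ p, (X.kind p).closedEulerChar - (cycleCount X.next : ℤ) := by
  have := X.finite_side
  have := X.finite_piece
  have := Fintype.ofFinite X.Piece
  rw [finsum_eq_sum_of_fintype, finsum_eq_sum_of_fintype,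
    cycleCount_eq_sum_fibres X.next X.owner X.owner_next, Nat.cast_sum, ← Finset.sum_sub_distrib]
  rfl

end SurfaceComplex

namespace Diagram

theorem cycleCount_glue (D : Diagram) : cycleCount D.glue = 2 * D.crossingNumber := by
  have h := two_mul_cycleCount_of_involution D.glue D.glue_glue D.glue_ne
  rw [Nat.card_prod, Nat.card_zmod] at h
  rw [crossingNumber]
  omega

theorem eulerChar_surface (D : Diagram) :
    D.surface.eulerChar =
      ∑ᶠ r, (2 - 2 * (D.genus r : ℤ)) - (cycleCount D.next : ℤ) - (D.crossingNumber : ℤ) := by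
  rw [SurfaceComplex.eulerChar, SurfaceComplex.finsum_pieceEulerChar]
  have h1 : cycleCount D.surface.rev = 2 * D.crossingNumber := D.cycleCount_glue
  have h2 : Nat.card D.surface.Vert = D.crossingNumber := rfl
  have h3 : cycleCount D.surface.next = cycleCount D.next := rfl
  have h4 : ∑ᶠ p, (D.surface.kind p).closedEulerChar = ∑ᶠ r, (2 - 2 * (D.genus r : ℤ)) := rfl
  rw [h1, h2, h3, h4]
  push_cast
  ring

/-! ### Euler characteristics of the twisted surfaces. -/

namespace Augmentation

variable {D : Diagram} {N : ℕ} (A : D.Augmentation N)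

/-- One step of `colNext` is two steps of `regionNext`, along a crossing arc and then along an edge,
so forgetting the second coordinate is a bijection on cycles. -/
theorem cycleCount_regionNext (col : Bool) :
    cycleCount (A.regionNext col) = cycleCount (A.colNext col) := by
  refine cycleCount_eq_card _
    (fun s => Quotient.mk (Equiv.Perm.SameCycle.setoid (A.colNext col)) s.1) ?_ fun a b => ?_
  · rintro ⟨x⟩
    exact ⟨(x, false), rfl⟩
  · constructor
    · intro h
      have hfalse : ∀ s, (A.regionNext col).SameCycle (s.1, false) s := by
        rintro ⟨x, _ | _⟩
        · exact Equiv.Perm.SameCycle.refl _ _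
        · exact ⟨1, rfl⟩
      have h' : (A.regionNext col).SameCycle (a.1, false) (b.1, false) :=
        sameCycle_map (f := fun x => (x, false)) (fun x => ⟨2, rfl⟩) (Quotient.exact h)
      exact ((hfalse a).symm.trans h').trans (hfalse b)
    · refine apply_eq_of_sameCycle (f := fun s : A.ColCorner col × Bool =>
        Quotient.mk (Equiv.Perm.SameCycle.setoid (A.colNext col)) s.1) ?_
      rintro ⟨x, _ | _⟩
      · rfl
      · exact Quotient.sound ⟨-1, by simp [regionNext]⟩

/-- The colour of a corner is constant along the boundary of its region, so the cycles of `next`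
split by colour. -/
theorem cycleCount_colNext_add :
    cycleCount (A.colNext true) + cycleCount (A.colNext false) = cycleCount A.K₂.next := by
  rw [cycleCount_eq_sum_fibres A.K₂.next (fun x => A.K₂.red (A.K₂.reg x))
    (fun x => by rw [A.K₂.reg_next_apply]), Fintype.sum_bool]
  congr 1 <;>
  exact (ncard_image_mk_eq_cycleCount_subtypePerm _ _ _).symm

theorem card_crossCircle_add :
    Nat.card (A.CrossCircle true) + Nat.card (A.CrossCircle false) = D.tw N := by
  have e : A.CrossCircle false ≃ {T : D.LargeTwistRegion N // ¬ A.K₂.red (A.sideReg T true) = true} :=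
    Equiv.subtypeEquivRight fun T => by simp
  rw [Nat.card_congr e, ← Nat.card_sum]
  classical
  exact Nat.card_congr (Equiv.sumCompl _)

theorem finsum_colReg_add (f : A.K₂.Reg → ℤ) :
    ∑ᶠ r : A.ColReg true, f r.1 + ∑ᶠ r : A.ColReg false, f r.1 = ∑ᶠ r, f r := by
  classical
  have := Fintype.ofFinite A.K₂.Reg
  simp only [finsum_eq_sum_of_fintype]
  rw [← Fintype.sum_subtype_add_sum_subtype (fun r => A.K₂.red r = true) f]
  congr 1
  exact Fintype.sum_equiv (Equiv.subtypeEquivRight fun r => by simp) _ _ fun _ => rfl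

/-- An annulus closes up to a sphere, and two Moebius bands close up to two projective planes. -/
theorem finsum_closedEulerChar_twistedSurface (col : Bool) :
    ∑ᶠ p, ((A.twistedSurface col).kind p).closedEulerChar =
      ∑ᶠ r : A.ColReg col, (2 - 2 * (A.K₂.genus r.1 : ℤ)) + 2 * (Nat.card (A.CrossCircle col) : ℤ) := by
  classical
  have := Fintype.ofFinite (A.ColReg col)
  have := Fintype.ofFinite (A.CrossCircle col)
  change ∑ᶠ p : A.ColReg col ⊕ ({T : A.CrossCircle col // Odd (A.fullTwists T.1)} ⊕
      ({T : A.CrossCircle col // ¬ Odd (A.fullTwists T.1)} × Bool)),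
      ((A.twistedSurface col).kind p).closedEulerChar = _
  rw [finsum_eq_sum_of_fintype, finsum_eq_sum_of_fintype, Fintype.sum_sum_type,
    Fintype.sum_sum_type]
  congr 1
  have h : Fintype.card {T : A.CrossCircle col // Odd (A.fullTwists T.1)} +
      Fintype.card {T : A.CrossCircle col // ¬ Odd (A.fullTwists T.1)} =
      Nat.card (A.CrossCircle col) := by
    rw [Nat.card_eq_fintype_card, ← Fintype.card_sum]
    exact Fintype.card_congr (Equiv.sumCompl _)
  rw [← h]
  simp [twistedSurface, SurfaceKind.closedEulerChar]
  ring

/-- The crossings give `2 cr` vertices, `2 cr` diagram edges and `cr` arcs, in total `-cr`. The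
vertex and the edge of a puncture cancel. A crossing circle gives `+2` from its closed-up bands and
`-4` from boundary circles, in total `-2`. -/
theorem eulerChar_twistedSurface (col : Bool) :
    (A.twistedSurface col).eulerChar =
      ∑ᶠ r : A.ColReg col, (2 - 2 * (A.K₂.genus r.1 : ℤ)) - (cycleCount (A.colNext col) : ℤ)
        - 2 * (Nat.card (A.CrossCircle col) : ℤ) - (A.K₂.crossingNumber : ℤ) := by
  rw [SurfaceComplex.eulerChar, SurfaceComplex.finsum_pieceEulerChar,
    finsum_closedEulerChar_twistedSurface]
  have hP : Nat.card (A.Puncture col) = Nat.card (A.CrossCircle col) * 2 := by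
    rw [Nat.card_prod, Nat.card_eq_fintype_card (α := Bool), Fintype.card_bool]
  have h1 : Nat.card (A.twistedSurface col).Vert =
      A.K₂.crossingNumber * 2 + Nat.card (A.CrossCircle col) * 2 := by
    change Nat.card ((A.K₂.Cr × Bool) ⊕ A.Puncture col) = _
    rw [Nat.card_sum, hP, Nat.card_prod, Nat.card_eq_fintype_card (α := Bool), Fintype.card_bool]
    rfl
  have h2 : cycleCount (A.twistedSurface col).rev =
      2 * A.K₂.crossingNumber + (A.K₂.crossingNumber + Nat.card (A.CrossCircle col) * 2) := by
    change cycleCount (Equiv.sumCongr A.K₂.glue (Equiv.sumCongr (flip _) (flip _))) = _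
    rw [cycleCount_sumCongr, cycleCount_sumCongr, cycleCount_flip, cycleCount_flip, hP,
      cycleCount_glue]
    rfl
  -- Each of the two punctures of a crossing circle bounds twice, once a region and once a band;
  -- each such circle is a single side, fixed by `next`.
  have h3 : cycleCount (A.twistedSurface col).next =
      cycleCount (A.colNext col) + Nat.card (A.CrossCircle col) * 2 * 2 := by
    change cycleCount (Equiv.sumCongr (A.regionNext col) (Equiv.refl (A.Puncture col × Bool))) = _
    rw [cycleCount_sumCongr, cycleCount_refl, cycleCount_regionNext, Nat.card_prod, hP,
      Nat.card_eq_fintype_card (α := Bool), Fintype.card_bool]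
  rw [h1, h2, h3]
  push_cast
  ring

/-- The Euler characteristics of the twisted surfaces in terms of the projection surface of the
reduced diagram. -/
theorem eulerChar_twistedSurface_add :
    (A.twistedSurface true).eulerChar + (A.twistedSurface false).eulerChar =
      A.K₂.surface.eulerChar - (A.K₂.crossingNumber : ℤ) - 2 * (D.tw N : ℤ) := by
  rw [eulerChar_twistedSurface, eulerChar_twistedSurface, eulerChar_surface,
    ← A.finsum_colReg_add (fun r => 2 - 2 * (A.K₂.genus r : ℤ)), ← A.cycleCount_colNext_add,
    ← A.card_crossCircle_add]
  push_cast
  ring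

end Augmentation

/-! The Euler characteristic of the projection surface of a knot diagram. -/

/-- Going once around a crossing, clockwise. -/
def rotate (D : Diagram) : Equiv.Perm D.Corner :=
  Equiv.prodCongr (Equiv.refl D.Cr) (Equiv.subRight (1 : ZMod 4))

theorem cycleCount_rotate (D : Diagram) : cycleCount D.rotate = D.crossingNumber := by
  refine cycleCount_eq_card _ Prod.fst Prod.fst_surjective fun a b => ⟨fun h => ?_, fun h => ?_⟩
  · obtain ⟨c, i⟩ := a
    obtain ⟨c', j⟩ := b
    obtain rfl : c = c' := h
    rcases Row.zmod_four_cases j i with h | h | h | h <;> subst h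
    · exact Equiv.Perm.SameCycle.refl _ _
    · exact ⟨1, by simp [rotate]⟩
    · exact ⟨2, show (c, j + 2 - 1 - 1) = (c, j) by ring_nf⟩
    · exact ⟨3, show (c, j + 3 - 1 - 1 - 1) = (c, j) by ring_nf⟩
  · exact apply_eq_of_sameCycle (fun _ => rfl) h

/-- The cycles of `rotate`, `glue` and their product are the vertices, the edges and the boundary
circles of the regions, which is the setting of the genus inequality. -/
theorem rotate_mul_glue (D : Diagram) : D.rotate * D.glue = D.next := rfl

theorem rotate_sq_mul_glue (D : Diagram) : D.rotate * D.rotate * D.glue = D.travel := by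
  ext d
  · rfl
  · exact (by decide : ∀ a : ZMod 4, a - 1 - 1 = a + 2) _

/-- Travelling along the knot is a word in `rotate` and `glue`, and it reaches every edge in one of
its two directions; a final `glue` reverses the direction. -/
theorem IsKnot.exists_mem_closure {D : Diagram} (h : D.IsKnot) (a b : D.Corner) :
    ∃ g ∈ Subgroup.closure {D.rotate, D.glue}, g a = b := by
  have hr : D.rotate ∈ Subgroup.closure {D.rotate, D.glue} := Subgroup.subset_closure (by simp)
  have hg : D.glue ∈ Subgroup.closure {D.rotate, D.glue} := Subgroup.subset_closure (by simp)
  have ht : D.travel ∈ Subgroup.closure {D.rotate, D.glue} := by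
    rw [← rotate_sq_mul_glue]
    exact mul_mem (mul_mem hr hr) hg
  rcases h.2 a b with ⟨n, hn⟩ | ⟨n, hn⟩
  · exact ⟨_, zpow_mem ht n, hn⟩
  · refine ⟨_, mul_mem hg (zpow_mem ht n), ?_⟩
    rw [Equiv.Perm.mul_apply, hn, D.glue_glue]

/-- The projection surface of a knot diagram is connected, so its Euler characteristic is at most
that of the sphere. -/
theorem IsKnot.eulerChar_surface_le {D : Diagram} (h : D.IsKnot) : D.surface.eulerChar ≤ 2 := by
  have hle := cycleCount_add_le_of_transitive D.rotate D.glue h.exists_mem_closure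
  rw [rotate_mul_glue, cycleCount_rotate, cycleCount_glue, Nat.card_prod,
    Nat.card_zmod] at hle
  -- Every region owns at least one boundary circle. With `b` circles this gives `χ ≤ 2 b - b - cr`,
  -- and the genus inequality on `4 cr` half-edges gives `b ≤ cr + 2`.
  have hc : ∑ᶠ r, (2 - 2 * (D.genus r : ℤ)) ≤ 2 * (cycleCount D.next : ℤ) := by
    classical
    have := Fintype.ofFinite D.Reg
    rw [finsum_eq_sum_of_fintype, cycleCount_eq_sum_fibres D.next D.reg D.reg_next, Nat.cast_sum,
      Finset.mul_sum]
    refine Finset.sum_le_sum fun r _ => ?_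
    obtain ⟨x, rfl⟩ := D.reg_surjective r
    have : 0 < ((Quotient.mk (Equiv.Perm.SameCycle.setoid D.next)) ''
        {a | D.reg a = D.reg x}).ncard := (Set.ncard_pos (Set.toFinite _)).2 ⟨_, x, rfl, rfl⟩
    omega
  rw [eulerChar_surface]
  unfold crossingNumber at *
  omega

end Diagram

/-! Removing pairs of crossings. -/

namespace Diagram

namespace Row

variable {D : Diagram} (t : D.Row)

/-- The remaining crossing of the row, as a crossing of the new diagram. -/
abbrev kept : t.Rest := ⟨t.c₁, t.ne₁₂, t.ne₁₃⟩

theorem old_kept : t.old (t.kept, t.i) = (t.c₃, t.k + 2) := by simp [old]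

theorem old_kept_one : t.old (t.kept, t.i + 1) = (t.c₃, t.k + 3) := by
  have : ∀ a : ZMod 4, a + 1 ≠ a := by decide
  simp [old, this]

theorem old_kept_two : t.old (t.kept, t.i + 2) = (t.c₁, t.i + 2) := by
  have : ∀ a : ZMod 4, a + 2 ≠ a ∧ a + 2 ≠ a + 1 := by decide
  simp [old, this]

theorem old_kept_three : t.old (t.kept, t.i + 3) = (t.c₁, t.i + 3) := by
  have : ∀ a : ZMod 4, a + 3 ≠ a ∧ a + 3 ≠ a + 1 := by decide
  simp [old, this]

theorem next_of_glue {c c' : D.Cr} {a a' b : ZMod 4} (h : D.glue (c', a') = (c, a))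
    (hb : a' - 1 = b) : D.next (c, a) = (c', b) := by
  rw [next_apply, ← h, D.glue_glue, hb]

theorem sub_one_eq_add_three : ∀ a : ZMod 4, a - 1 = a + 3 := by decide

/-- The two regions beside the row pass its crossings in opposite orders: one runs through `c₃`,
`c₂`, `c₁`, the other through `c₁`, `c₂`, `c₃`. In each of them the removal skips the first two of
these corners. -/
theorem next_near_one : D.next (t.c₃, t.k + 1) = (t.c₂, t.j + 1) :=
  next_of_glue t.glue₃ (by ring)

theorem next_near_two : D.next (t.c₂, t.j + 1) = (t.c₁, t.i + 3) :=
  next_of_glue t.glue₁ (sub_one_eq_add_three _)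

theorem next_far_one : D.next (t.c₁, t.i + 1) = (t.c₂, t.j + 3) :=
  next_of_glue t.glue₂ (sub_one_eq_add_three _)

theorem next_far_two : D.next (t.c₂, t.j + 3) = (t.c₃, t.k + 3) := by
  rw [show t.j + 3 = t.j + 2 + 1 by ring]
  exact next_of_glue t.glue₄ (sub_one_eq_add_three _)

/-- Going from a corner to the next one in the new diagram, one passes over the corners of the
removed crossings in the old diagram. -/
theorem next_old (d : t.Rest × ZMod 4) :
    D.next (t.old d) = t.old ((D.removePair t).next d) ∨
      (D.next (t.old d) = (t.c₃, t.k + 1) ∧ (D.removePair t).next d = (t.kept, t.i + 3)) ∨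
      (D.next (t.old d) = (t.c₁, t.i + 1) ∧ (D.removePair t).next d = (t.kept, t.i + 1)) := by
  have hn : (D.removePair t).next d = ((t.newGlue d).1, (t.newGlue d).2 - 1) := rfl
  rw [hn, next_apply, ← t.old_newGlue]
  -- Only the half-edge `e` of arrival matters. Turning clockwise from it commutes with `old`,
  -- except at `(kept, i)` and `(kept, i + 2)`, where the turn leads between half-edges that come
  -- from `c₃` and from `c₁`.
  generalize t.newGlue d = e
  obtain ⟨⟨c, hc⟩, a⟩ := e
  have e1 : ∀ a : ZMod 4, a - 1 = a + 3 ∧ a + 1 - 1 = a ∧ a + 2 - 1 = a + 1 ∧ a + 3 - 1 = a + 2 := by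
    decide
  by_cases h : c = t.c₁
  · subst h
    obtain ⟨h0, h1, h2, h3⟩ := e1 t.i
    obtain ⟨-, -, k2, k3⟩ := e1 t.k
    rcases zmod_four_cases t.i a with h | h | h | h <;> subst h
    · right; left
      rw [t.old_kept, h0, k2]
      exact ⟨rfl, rfl⟩
    · left
      rw [t.old_kept_one, h1, k3, t.old_kept]
    · right; right
      rw [t.old_kept_two, h2]
      exact ⟨rfl, rfl⟩
    · left
      rw [t.old_kept_three, h3, t.old_kept_two]
  · left
    simp [old, h]

theorem sameCycle_old {a b : t.Rest × ZMod 4} (h : (D.removePair t).next.SameCycle a b) :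
    D.next.SameCycle (t.old a) (t.old b) := by
  refine sameCycle_map (fun d => ?_) h
  rcases t.next_old d with h | ⟨h, h'⟩ | ⟨h, h'⟩
  · exact ⟨1, h⟩
  -- One step reaches the first of the two skipped corners, and two more lead past them.
  · refine ⟨3, show D.next (D.next (D.next _)) = _ from ?_⟩
    rw [h, t.next_near_one, t.next_near_two, ← t.old_kept_three]
    exact congrArg t.old h'.symm
  · refine ⟨3, show D.next (D.next (D.next _)) = _ from ?_⟩
    rw [h, t.next_far_one, t.next_far_two, ← t.old_kept_one]
    exact congrArg t.old h'.symm

/-- The corner `d` of the new diagram is the first one to be met from the old corner `y` on. -/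
def Meets (y : D.Corner) (d : t.Rest × ZMod 4) : Prop :=
  t.old d = y ∨ (d = (t.kept, t.i + 3) ∧ (y = (t.c₃, t.k + 1) ∨ y = (t.c₂, t.j + 1))) ∨
    (d = (t.kept, t.i + 1) ∧ (y = (t.c₁, t.i + 1) ∨ y = (t.c₂, t.j + 3)))

/-- An old step either stays before the new corner ahead or starts from that corner itself, and then
its successor is the next one to be met. -/
theorem Meets.next {y : D.Corner} {d : t.Rest × ZMod 4} (h : t.Meets y d) :
    t.Meets (D.next y) d ∨ t.Meets (D.next y) ((D.removePair t).next d) := by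
  rcases h with rfl | ⟨rfl, rfl | rfl⟩ | ⟨rfl, rfl | rfl⟩
  · right
    rcases t.next_old d with h | h | h
    · exact Or.inl h.symm
    · exact Or.inr (Or.inl ⟨h.2, Or.inl h.1⟩)
    · exact Or.inr (Or.inr ⟨h.2, Or.inl h.1⟩)
  · exact Or.inl (Or.inr (Or.inl ⟨rfl, Or.inr t.next_near_one⟩))
  · exact Or.inl (Or.inl (by rw [t.next_near_two, t.old_kept_three]))
  · exact Or.inl (Or.inr (Or.inr ⟨rfl, Or.inr t.next_far_one⟩))
  · exact Or.inl (Or.inl (by rw [t.next_far_two, t.old_kept_one]))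

theorem Meets.eq_of_old {d e : t.Rest × ZMod 4} (h : t.Meets (t.old e) d) : d = e := by
  have hg := t.not_gone_old e
  rcases h with h | ⟨-, h | h⟩ | ⟨-, h | h⟩
  · exact t.old_injective h
  all_goals exact absurd (by rw [h]; simp [Gone]) hg

/-- Along the old orbit the new corner ahead only ever advances by the new `next`. At a surviving
corner it is that corner itself. -/
theorem sameCycle_of_old {a b : t.Rest × ZMod 4} (h : D.next.SameCycle (t.old a) (t.old b)) :
    (D.removePair t).next.SameCycle a b := by
  have := D.finite_cr
  have : Finite D.Corner := inferInstance
  obtain ⟨n, hn⟩ := h.exists_nat_pow_eq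
  have key : ∀ n : ℕ, ∃ d, t.Meets ((D.next ^ n) (t.old a)) d ∧
      (D.removePair t).next.SameCycle a d := by
    intro n
    induction n with
    | zero => exact ⟨a, Or.inl rfl, Equiv.Perm.SameCycle.refl _ _⟩
    | succ n ih =>
      obtain ⟨d, hd, had⟩ := ih
      rw [pow_succ', Equiv.Perm.mul_apply]
      rcases hd.next with h | h
      · exact ⟨d, h, had⟩
      · exact ⟨_, h, Equiv.Perm.sameCycle_apply_right.2 had⟩
  obtain ⟨d, hd, had⟩ := key n
  rw [hn] at hd
  exact hd.eq_of_old ▸ had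

theorem reg_bigons_ne : D.reg (t.c₁, t.i) ≠ D.reg (t.c₂, t.j + 2) := by
  intro h
  have e : ∀ a : ZMod 4, a + 2 ≠ a := by decide
  rcases t.bigon₁.2.2 _ h.symm with h | h
  · exact t.ne₁₂ (congrArg Prod.fst h).symm
  · rw [t.next₁] at h
    exact e _ (congrArg Prod.snd h)

/-- Every old corner lies on one of the two bigons or on the boundary circle of a remaining
corner. -/
theorem exists_sameCycle (x : D.Corner) :
    D.next.SameCycle (t.c₁, t.i) x ∨ D.next.SameCycle (t.c₂, t.j + 2) x ∨
      ∃ d, D.next.SameCycle (t.old d) x := by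
  by_cases hx : t.Gone x
  · have far : D.next.SameCycle (t.old (t.kept, t.i + 1)) (t.c₂, t.j + 3) := by
      rw [t.old_kept_one, ← t.next_far_two]
      exact Equiv.Perm.sameCycle_apply_left.2 (Equiv.Perm.SameCycle.refl _ _)
    have near : D.next.SameCycle (t.old (t.kept, t.i + 3)) (t.c₂, t.j + 1) := by
      rw [t.old_kept_three, ← t.next_near_two]
      exact Equiv.Perm.sameCycle_apply_left.2 (Equiv.Perm.SameCycle.refl _ _)
    obtain ⟨c, a⟩ := x
    rcases hx with h | ⟨h, h' | h'⟩ | ⟨h, h' | h'⟩ <;> simp only at h <;> subst h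
    · rcases zmod_four_cases t.j a with h | h | h | h <;> subst h
      · exact Or.inl ⟨1, t.next₁⟩
      · exact Or.inr (Or.inr ⟨_, near⟩)
      · exact Or.inr (Or.inl (Equiv.Perm.SameCycle.refl _ _))
      · exact Or.inr (Or.inr ⟨_, far⟩)
    all_goals
      simp only at h'
      subst h'
    · exact Or.inl (Equiv.Perm.SameCycle.refl _ _)
    · refine Or.inr (Or.inr ⟨(t.kept, t.i + 1), Equiv.Perm.sameCycle_apply_right.1 ?_⟩)
      rw [t.next_far_one]
      exact far
    · exact Or.inr (Or.inl ⟨1, t.next₂⟩)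
    · refine Or.inr (Or.inr ⟨(t.kept, t.i + 3), Equiv.Perm.sameCycle_apply_right.1 ?_⟩)
      rw [t.next_near_one]
      exact near
  · obtain ⟨d, rfl⟩ := t.exists_old hx
    exact Or.inr (Or.inr ⟨d, Equiv.Perm.SameCycle.refl _ _⟩)

/-- The old boundary circles are the new ones with the skipped corners reinserted, together with the
circles of the two bigons. -/
theorem cycleCount_next_removePair :
    cycleCount D.next = cycleCount (D.removePair t).next + 2 := by
  let m : D.Corner → Quotient (Equiv.Perm.SameCycle.setoid D.next) := Quotient.mk _
  let q : (D.removePair t).Corner → Quotient (Equiv.Perm.SameCycle.setoid (D.removePair t).next) :=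
    Quotient.mk _
  let g : Quotient (Equiv.Perm.SameCycle.setoid (D.removePair t).next) ⊕ Bool →
      Quotient (Equiv.Perm.SameCycle.setoid D.next) :=
    Sum.elim (Quotient.lift (s := Equiv.Perm.SameCycle.setoid (D.removePair t).next)
        (fun d => m (t.old d)) fun _ _ h => Quotient.sound (t.sameCycle_old h))
      fun b => if b then m (t.c₁, t.i) else m (t.c₂, t.j + 2)
  -- The region is an invariant of a cycle; it separates the bigons from each other and from all
  -- remaining circles.
  have hreg : ∀ {x y : D.Corner}, m x = m y → D.reg x = D.reg y := fun h =>
    apply_eq_of_sameCycle D.reg_next_apply (Quotient.exact h)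
  have hinj : Function.Injective g := by
    rw [Function.Injective, Sum.forall]
    constructor
    · rintro ⟨d⟩ (⟨⟨e⟩⟩ | ⟨_ | _⟩) h
      · exact congrArg Sum.inl (Quotient.sound (t.sameCycle_of_old (Quotient.exact h)))
      · exact absurd (hreg h) (t.reg_old_ne d).2
      · exact absurd (hreg h) (t.reg_old_ne d).1
    · rintro (_ | _) (⟨⟨e⟩⟩ | ⟨_ | _⟩) h
      · exact absurd (hreg h).symm (t.reg_old_ne e).2
      · rfl
      · exact absurd (hreg h).symm t.reg_bigons_ne
      · exact absurd (hreg h).symm (t.reg_old_ne e).1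
      · exact absurd (hreg h) t.reg_bigons_ne
      · rfl
  have hsurj : Function.Surjective g := by
    rintro ⟨x⟩
    rcases t.exists_sameCycle x with h | h | ⟨d, h⟩
    · exact ⟨Sum.inr true, Quotient.sound h⟩
    · exact ⟨Sum.inr false, Quotient.sound h⟩
    · exact ⟨Sum.inl (q d), Quotient.sound h⟩
  have := (D.removePair t).finite_cr
  have h := Nat.card_congr (Equiv.ofBijective g ⟨hinj, hsurj⟩)
  rw [Nat.card_sum, Nat.card_eq_fintype_card (α := Bool), Fintype.card_bool] at h
  exact h.symm

theorem crossingNumber_removePair :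
    D.crossingNumber = (D.removePair t).crossingNumber + 2 := by
  classical
  have := Fintype.ofFinite D.Cr
  have h : Nat.card {c : D.Cr // ¬ (c ≠ t.c₂ ∧ c ≠ t.c₃)} = 2 := by
    rw [← Set.ncard_pair t.ne₂₃, ← Nat.card_coe_set_eq]
    exact Nat.card_congr (Equiv.subtypeEquivRight fun c => by
      simp only [Set.mem_insert_iff, Set.mem_singleton_iff]; tauto)
  rw [← h]
  change Nat.card D.Cr = Nat.card t.Rest + _
  rw [← Nat.card_sum]
  exact (Nat.card_congr (Equiv.sumCompl _)).symm

theorem finsum_reg_removePair :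
    ∑ᶠ r, (2 - 2 * (D.genus r : ℤ)) =
      ∑ᶠ r, (2 - 2 * ((D.removePair t).genus r : ℤ)) + 4 := by
  classical
  have := Fintype.ofFinite D.Reg
  have := Fintype.ofFinite (D.removePair t).Reg
  let P : D.Reg → Prop := fun r => r ≠ D.reg (t.c₁, t.i) ∧ r ≠ D.reg (t.c₂, t.j + 2)
  rw [finsum_eq_sum_of_fintype, finsum_eq_sum_of_fintype,
    ← Finset.sum_filter_add_sum_filter_not Finset.univ P]
  congr 1
  · rw [Finset.sum_subtype (p := P) _ (by simp)]
    rfl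
  · have h : Finset.univ.filter (fun r => ¬ P r) = {D.reg (t.c₁, t.i), D.reg (t.c₂, t.j + 2)} := by
      ext r
      simp only [P, Finset.mem_filter, Finset.mem_univ, true_and, Finset.mem_insert,
        Finset.mem_singleton]
      tauto
    rw [h, Finset.sum_pair t.reg_bigons_ne, t.bigon₁.1, t.bigon₂.1]
    norm_num

/-- Removing a pair of crossings does not change the projection surface. -/
theorem eulerChar_surface_removePair :
    (D.removePair t).surface.eulerChar = D.surface.eulerChar := by
  -- The old diagram exceeds the new one by 4 for the closed-up bigons, by 2 boundary circles and by
  -- 2 crossings, and `4 - 2 - 2 = 0`.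
  rw [eulerChar_surface, eulerChar_surface, t.cycleCount_next_removePair,
    t.crossingNumber_removePair, t.finsum_reg_removePair]
  push_cast
  ring

end Row

/-! ### Sequences of removals. -/

theorem PairRemovals.eulerChar_surface {D : Diagram} {N : ℕ} {D' : Diagram} {f : D'.Cr → D.Cr}
    (h : PairRemovals D N D' f) : D'.surface.eulerChar = D.surface.eulerChar := by
  induction h with
  | refl => rfl
  | step D' f t _ _ _ _ ih => rw [t.eulerChar_surface_removePair, ih]

/-- A removal takes place only in a large twist region. This dichotomy decides the sign of the sum
of Euler characteristics. -/
theorem PairRemovals.eq_or_nonempty {D : Diagram} {N : ℕ} {D' : Diagram} {f : D'.Cr → D.Cr}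
    (h : PairRemovals D N D' f) : D' = D ∨ Nonempty (D.LargeTwistRegion N) := by
  cases h with
  | refl => exact Or.inl rfl
  | step D' f t _ large _ _ => exact Or.inr ⟨⟨_, large⟩⟩

end Diagram

/-! ### The sign of the sum, and the conclusion. -/

theorem lemma3p7 (D : Diagram) (hknot : D.IsKnot) (halt : D.IsAlternating)
    (hsphere : D.surface.eulerChar = 2 → 2 ≤ D.crossingNumber)
    (N : ℕ) (hN : 3 ≤ N) (A : D.Augmentation N) :
    |(A.twistedSurface true).eulerChar + (A.twistedSurface false).eulerChar| =
      (A.K₂.crossingNumber : ℤ) + 2 * (D.tw N : ℤ) - D.surface.eulerChar := by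
  have hle := hknot.eulerChar_surface_le
  have hbound : D.surface.eulerChar ≤ (A.K₂.crossingNumber : ℤ) + 2 * (D.tw N : ℤ) := by
    rcases A.removals.eq_or_nonempty with h | h
    · have hpos : 0 < D.crossingNumber := by
        have := hknot.1
        exact Nat.card_pos
      rw [h]
      -- With `K₂ = D`, two crossings suffice if `χ(F) = 2`; otherwise `χ(F) ≤ 1` and one crossing
      -- suffices.
      by_cases h2 : D.surface.eulerChar = 2
      · have := hsphere h2
        omega
      · omega
    · have : Finite D.TwistRegion := Quot.finite _
      -- A single large twist region already gives `2 tw ≥ 2 ≥ χ(F)`.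
      have hpos : 0 < D.tw N := Nat.card_pos
      omega
  rw [A.eulerChar_twistedSurface_add, A.removals.eulerChar_surface, abs_of_nonpos (by omega)]
  ring
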